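/- Let $n\ge 1$, let $\Omega\subset\mathbb R^n$ be a non-empty open set, and write $L^2=L^2_{\mathbb C}(\Omega)$. For $1\le j\le n$ let $\partial^{e_j}$ be the weak partial derivative in $L^2$, i.e. minus the adjoint of $C_0^\infty(\Omega,\mathbb C)\to L^2$, $f\mapsto\partial f/\partial x_j$. Let $W^1(\Omega)=\bigcap_j D(\partial^{e_j})$ with the norm $(\|u\|_2^2+\sum_j\|\partial^{e_j}u\|_2^2)^{1/2}$, let $W^1_0(\Omega)$ be the closure of $C_0^\infty(\Omega,\mathbb C)$ in $W^1(\Omega)$, let $\nabla_w=(\partial^{e_1},\dots,\partial^{e_n}):W^1(\Omega)\to (L^2)^n$, let $\nabla_0:C_0^\infty(\Omega,\mathbb C)\to(L^2)^n$ be the classical gradient, regarded as a densely defined operator in $L^2$, and let $\nabla_0^*$ be its adjoint. Let $\mathcal L$ be the set of real $\bar p\in L^\infty(\Omega)$ that are a.e. bounded from below by a positive constant. For $\bar p\in\mathcal L$ let $A_{\bar p}$ be the operator in $L^2$ with $$D(A_{\bar p})=\{u\in W^1_0(\Omega):\ (1/\bar p)\nabla_w u\in D(\nabla_0^*)\},\qquad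 A_{\bar p}u=\nabla_0^*\,(1/\bar p)\,\nabla_w u,$$ and let $\hat A$ be the operator in $L^2\times(L^2)^n$ with domain $W^1_0(\Omega)\times D(\nabla_0^*)$ and $$\hat A(u,q)=(\nabla_0^* q,\ \nabla_w u-\bar p\,q).$$ Assume that there are $c>0$ and $j\in\{1,\dots,n\}$ with $\|\partial^{e_j}f\|_2\ge c\,\|f\|_2$ for all $f\in W^1_0(\Omega)$. **Theorem.** Let $\bar p\in\mathcal L$ and let $C_2\ge C_1>0$ be real numbers with $C_1\le\bar p\le C_2$ a.e. on $\Omega$. Then the interval $$J=\left(-C_1,\ \frac{c^2}{c+C_2}\right)$$ is contained in the resolvent set of $\hat A$. Moreover, for every $\lambda\in J$, with $\bar p_\lambda=\bar p+\lambda$ and $p_\lambda=1/\bar p_\lambda$: $\bar p_\lambda\in\mathcal L$, $p_\lambda\in L^\infty(\Omega)$, and $\lambda$ belongs to the resolvent set of $A_{\bar p_\lambda}$; the operators $\nabla_w(A_{\bar p_\lambda}-\lambda)^{-1}$, $\overline{(A_{\bar p_\lambda}-\lambda)^{-1}\nabla_0^*}$ and $\overline{\nabla_w(A_{\bar p_\lambda}-\lambda)^{-1}\nabla_0^*}$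 exist as bounded, everywhere defined operators (the overline denotes the closure of a closable operator); and for all $(f,g)\in L^2\times(L^2)^n$ $$(\hat A-\lambda)^{-1}(f,g)=\Big((A_{\bar p_\lambda}-\lambda)^{-1}f+\overline{(A_{\bar p_\lambda}-\lambda)^{-1}\nabla_0^*}\,p_\lambda g\,,\ -p_\lambda g+p_\lambda\nabla_w(A_{\bar p_\lambda}-\lambda)^{-1}f+p_\lambda\,\overline{\nabla_w(A_{\bar p_\lambda}-\lambda)^{-1}\nabla_0^*}\,p_\lambda g\Big).$$ -/

import Mathlib

open MeasureTheory TopologicalSpace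
open scoped Distributions ENNReal

noncomputable section

namespace Diffusion

/-! ### Operator-theoretic preliminaries -/

section Operators

variable {X Y Z : Type*} [NormedAddCommGroup X] [NormedSpace ℂ X]
  [NormedAddCommGroup Y] [NormedSpace ℂ Y] [NormedAddCommGroup Z] [NormedSpace ℂ Z]

/-- Composition `S ∘ T` of unbounded operators on its natural domain
`{x ∈ D(T) | T x ∈ D(S)}`. -/
def compOp (S : Y →ₗ.[ℂ] Z) (T : X →ₗ.[ℂ] Y) : X →ₗ.[ℂ] Z where
  domain := (S.domain.comap T.toFun).map T.domain.subtype
  toFun :=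
    { toFun := fun x => S ⟨T ⟨x, by
          obtain ⟨y, -, hy⟩ := x.2
          exact hy ▸ y.2⟩, by
          obtain ⟨x, y, hy, rfl⟩ := x
          exact hy⟩
      map_add' := fun x y => by
        rw [← LinearPMap.map_add]
        congr 1
        apply Subtype.ext
        simp only [Submodule.coe_add, ← LinearPMap.map_add]
        rfl
      map_smul' := fun a x => by
        rw [RingHom.id_apply, ← LinearPMap.map_smul]
        congr 1
        apply Subtype.ext
        simp only [Submodule.coe_smul, ← LinearPMap.map_smul]
        rfl }

/-- The bounded operator `R` on `X` is the inverse of `T - z : D(T) → X`. -/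
def IsResolventAt (T : X →ₗ.[ℂ] X) (z : ℂ) (R : X →L[ℂ] X) : Prop :=
  (∀ x : T.domain, R (T x - z • (x : X)) = x) ∧
    ∀ y : X, ∃ h : R y ∈ T.domain, T ⟨R y, h⟩ - z • R y = y

/-- The resolvent set of an unbounded operator: all `z` for which `T - z : D(T) → X` is bijective
with a bounded inverse. -/
def opResolventSet (T : X →ₗ.[ℂ] X) : Set ℂ :=
  {z | ∃ R : X →L[ℂ] X, IsResolventAt T z R}

open Classical in
/-- The resolvent `(T - z)⁻¹` at a point `z` of the resolvent set of `T`. -/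
def opResolvent (T : X →ₗ.[ℂ] X) (z : ℂ) : X →L[ℂ] X :=
  if h : ∃ R : X →L[ℂ] X, IsResolventAt T z R then h.choose else 0

/-- The inverse of `T - z` is unique, so that `opResolvent` is well defined. -/
theorem IsResolventAt.eq_opResolvent {T : X →ₗ.[ℂ] X} {z : ℂ} {R : X →L[ℂ] X}
    (hR : IsResolventAt T z R) : opResolvent T z = R := by
  have h : ∃ R : X →L[ℂ] X, IsResolventAt T z R := ⟨R, hR⟩
  have h' : IsResolventAt T z (opResolvent T z) := by
    rw [opResolvent, dif_pos h]
    exact h.choose_spec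
  ext y
  obtain ⟨hy, hy'⟩ := hR.2 y
  have := h'.1 ⟨R y, hy⟩
  simpa only [hy'] using this

end Operators

/-! ### Function spaces on an open set -/

variable {n : ℕ} (Ω : Opens (EuclideanSpace ℝ (Fin n)))

/-- Lebesgue measure on `Ω`. -/
abbrev leb : Measure (EuclideanSpace ℝ (Fin n)) := volume.restrict (Ω : Set _)

/-- The complex Hilbert space `L²(Ω)`. -/
abbrev L2 : Type := Lp ℂ 2 (leb Ω)

/-- The complex Hilbert space `(L²(Ω))ⁿ`. -/
abbrev L2n : Type := PiLp 2 (fun _ : Fin n => L2 Ω)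

/-- The complex Hilbert space `L²(Ω) × (L²(Ω))ⁿ`. -/
abbrev L2xL2n : Type := WithLp 2 (L2 Ω × L2n Ω)

theorem memLp_test (φ : 𝓓(Ω, ℂ)) : MemLp φ 2 (leb Ω) :=
  φ.continuous.memLp_of_hasCompactSupport φ.hasCompactSupport

/-- The map sending a test function to its class in `L²(Ω)`. -/
def testToL2 : 𝓓(Ω, ℂ) →ₗ[ℂ] L2 Ω where
  toFun φ := (memLp_test Ω φ).toLp φ
  map_add' _ _ := rfl
  map_smul' _ _ := rfl

theorem testToL2_injective : Function.Injective (testToL2 Ω) := by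
  intro φ ψ h
  have h1 : (φ : EuclideanSpace ℝ (Fin n) → ℂ) =ᵐ[leb Ω] ψ :=
    (MemLp.toLp_eq_toLp_iff (memLp_test Ω φ) (memLp_test Ω ψ)).1 h
  have h2 : Set.EqOn φ ψ (Ω : Set _) :=
    Measure.eqOn_open_of_ae_eq h1 Ω.isOpen φ.continuous.continuousOn ψ.continuous.continuousOn
  refine TestFunction.ext fun x => ?_
  by_cases hx : x ∈ (Ω : Set (EuclideanSpace ℝ (Fin n)))
  · exact h2 hx
  · rw [image_eq_zero_of_notMem_tsupport fun h => hx (φ.tsupport_subset h),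
      image_eq_zero_of_notMem_tsupport fun h => hx (ψ.tsupport_subset h)]

/-- `C₀^∞(Ω)` as a subspace of `L²(Ω)`. -/
def testSpace : Submodule ℂ (L2 Ω) := LinearMap.range (testToL2 Ω)

/-- `C₀^∞(Ω)` and its image in `L²(Ω)` are identified. -/
def testEquiv : 𝓓(Ω, ℂ) ≃ₗ[ℂ] testSpace Ω :=
  LinearEquiv.ofInjective (testToL2 Ω) (testToL2_injective Ω)

/-- The classical partial derivative `∂/∂x_j` of test functions. -/
def testDeriv (j : Fin n) : 𝓓(Ω, ℂ) →ₗ[ℂ] 𝓓(Ω, ℂ) :=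
  (TestFunction.lineDerivCLM ℂ (EuclideanSpace.single j (1 : ℝ)) :
    𝓓(Ω, ℂ) →L[ℂ] 𝓓(Ω, ℂ)).toLinearMap

theorem testDeriv_apply (j : Fin n) (φ : 𝓓(Ω, ℂ)) (x : EuclideanSpace ℝ (Fin n)) :
    testDeriv Ω j φ x = fderiv ℝ φ x (EuclideanSpace.single j 1) := by
  have h : testDeriv Ω j φ x = lineDeriv ℝ φ x (EuclideanSpace.single j 1) :=
    TestFunction.lineDerivCLM_apply_of_le (by simp)
  rw [h, DifferentiableAt.lineDeriv_eq_fderiv]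
  exact (φ.contDiff.differentiable (by simp)).differentiableAt

/-- The operator `f ↦ ∂f/∂x_j` in `L²(Ω)` with domain `C₀^∞(Ω)`. -/
def classicalDeriv (j : Fin n) : L2 Ω →ₗ.[ℂ] L2 Ω where
  domain := testSpace Ω
  toFun := testToL2 Ω ∘ₗ testDeriv Ω j ∘ₗ (testEquiv Ω).symm.toLinearMap

/-- The weak partial derivative `∂^{e_j}`, i.e. minus the adjoint of `classicalDeriv`. -/
def weakDeriv (j : Fin n) : L2 Ω →ₗ.[ℂ] L2 Ω := -(classicalDeriv Ω j).adjoint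

/-- The Sobolev space `W¹(Ω)`. -/
def W1 : Submodule ℂ (L2 Ω) := ⨅ j, (weakDeriv Ω j).domain

theorem W1_le (j : Fin n) : W1 Ω ≤ (weakDeriv Ω j).domain := iInf_le _ j

/-- The gradient `∇₀` in `L²(Ω)` with values in `(L²(Ω))ⁿ` and domain `C₀^∞(Ω)`. -/
def grad0 : L2 Ω →ₗ.[ℂ] L2n Ω where
  domain := testSpace Ω
  toFun := (WithLp.linearEquiv 2 ℂ (Fin n → L2 Ω)).symm.toLinearMap ∘ₗ
    LinearMap.pi fun j => (classicalDeriv Ω j).toFun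

/-- The weak gradient `∇_w` in `L²(Ω)` with values in `(L²(Ω))ⁿ` and domain `W¹(Ω)`. -/
def gradW : L2 Ω →ₗ.[ℂ] L2n Ω where
  domain := W1 Ω
  toFun := (WithLp.linearEquiv 2 ℂ (Fin n → L2 Ω)).symm.toLinearMap ∘ₗ
    LinearMap.pi fun j => (weakDeriv Ω j).toFun ∘ₗ Submodule.inclusion (W1_le Ω j)

/-- `u ↦ (u, ∇_w u)`. The norm of `W¹(Ω)` is the one that makes this map an isometry. -/
def W1Embedding : W1 Ω →ₗ[ℂ] L2xL2n Ω :=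
  (WithLp.linearEquiv 2 ℂ (L2 Ω × L2n Ω)).symm.toLinearMap ∘ₗ
    (W1 Ω).subtype.prod (gradW Ω).toFun

/-- The Sobolev space `W¹₀(Ω)`: the closure of `C₀^∞(Ω)` in `W¹(Ω)` with respect to the norm of
`W¹(Ω)`. -/
def W10 : Submodule ℂ (L2 Ω) :=
  Submodule.map (W1 Ω).subtype <| Submodule.comap (W1Embedding Ω) <|
    Submodule.topologicalClosure <| Submodule.map (W1Embedding Ω) <|
      Submodule.comap (W1 Ω).subtype (testSpace Ω)

theorem W10_le_W1 : W10 Ω ≤ W1 Ω := Submodule.map_subtype_le _ _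

/-- The restriction of `∇_w` to `W¹₀(Ω)`. -/
def gradW10 : L2 Ω →ₗ.[ℂ] L2n Ω where
  domain := W10 Ω
  toFun := (gradW Ω).toFun ∘ₗ Submodule.inclusion (W10_le_W1 Ω)

/-- The adjoint `∇₀^*` of `∇₀`. -/
def grad0Adj : L2n Ω →ₗ.[ℂ] L2 Ω := (grad0 Ω).adjoint

/-! ### Multiplication operators -/

/-- The maximal multiplication operator in `L²(Ω)` by the function `m`. -/
def mulOp (m : EuclideanSpace ℝ (Fin n) → ℝ) : L2 Ω →ₗ.[ℂ] L2 Ω where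
  domain :=
    { carrier := {f | MemLp (fun x => (m x : ℂ) * f x) 2 (leb Ω)}
      zero_mem' := by
        refine (MemLp.zero (ε := ℂ)).ae_eq ?_
        filter_upwards [Lp.coeFn_zero ℂ 2 (leb Ω)] with x hx
        simp only [hx, Pi.zero_apply, mul_zero]
      add_mem' := fun {f g} hf hg => by
        refine (MemLp.add hf hg).ae_eq ?_
        filter_upwards [Lp.coeFn_add f g] with x hx
        simp only [hx, Pi.add_apply, mul_add]
      smul_mem' := fun a f hf => by
        refine (MemLp.const_smul hf a).ae_eq ?_
        filter_upwards [Lp.coeFn_smul a f] with x hx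
        simp only [hx, Pi.smul_apply, smul_eq_mul, mul_left_comm] }
  toFun :=
    { toFun := fun f => MemLp.toLp (fun x => (m x : ℂ) * (f : L2 Ω) x) f.2
      map_add' := fun f g => by
        rw [← MemLp.toLp_add]
        refine MemLp.toLp_congr _ _ ?_
        filter_upwards [Lp.coeFn_add (f : L2 Ω) (g : L2 Ω)] with x hx
        simp only [Submodule.coe_add, hx, Pi.add_apply, mul_add]
      map_smul' := fun a f => by
        rw [RingHom.id_apply, ← MemLp.toLp_const_smul]
        refine MemLp.toLp_congr _ _ ?_
        filter_upwards [Lp.coeFn_smul a (f : L2 Ω)] with x hx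
        simp only [Submodule.coe_smul, hx, Pi.smul_apply, smul_eq_mul, mul_left_comm] }

/-- The componentwise maximal multiplication operator in `(L²(Ω))ⁿ` by the function `m`. -/
def mulOpVec (m : EuclideanSpace ℝ (Fin n) → ℝ) : L2n Ω →ₗ.[ℂ] L2n Ω where
  domain := ⨅ j, (mulOp Ω m).domain.comap (PiLp.projₗ 2 (fun _ : Fin n => L2 Ω) j)
  toFun := (WithLp.linearEquiv 2 ℂ (Fin n → L2 Ω)).symm.toLinearMap ∘ₗ
    LinearMap.pi fun j => (mulOp Ω m).toFun ∘ₗ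
      (LinearMap.restrict (PiLp.projₗ 2 (fun _ : Fin n => L2 Ω) j)
        fun _ hq => (Submodule.mem_iInf _).1 hq j)

variable {Ω} in
theorem mulOpVec_domain {m : EuclideanSpace ℝ (Fin n) → ℝ} (hm : MemLp m ∞ (leb Ω))
    (q : L2n Ω) : q ∈ (mulOpVec Ω m).domain := by
  refine (Submodule.mem_iInf _).2 fun j => ?_
  have hm' : MemLp (fun x => (m x : ℂ)) ∞ (leb Ω) := hm.ofReal
  exact MemLp.mul' (r := 2) (Lp.memLp (q j)) hm'

variable {Ω} in
/-- Multiplication by `m ∈ L^∞(Ω)`, as an everywhere defined operator on `(L²(Ω))ⁿ`. -/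
def mulVec (m : EuclideanSpace ℝ (Fin n) → ℝ) (hm : MemLp m ∞ (leb Ω)) : L2n Ω →ₗ[ℂ] L2n Ω :=
  (mulOpVec Ω m).toFun ∘ₗ LinearMap.codRestrict _ LinearMap.id (mulOpVec_domain hm)

/-! ### The diffusion operator and the first order operator -/

/-- The set `𝓛` of functions in `L^∞(Ω)` that are a.e. bounded from below by a positive
constant. -/
def diffusivities : Set (EuclideanSpace ℝ (Fin n) → ℝ) :=
  {p | MemLp p ∞ (leb Ω) ∧
    ∃ C₁ C₂ : ℝ, 0 < C₁ ∧ C₁ ≤ C₂ ∧ ∀ᵐ x ∂(leb Ω), C₁ ≤ p x ∧ p x ≤ C₂}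

/-- The diffusion operator `A_p = ∇₀^* (1/p) ∇_w` in `L²(Ω)` on the domain of all `u ∈ W¹₀(Ω)` such
that `(1/p) ∇_w u` belongs to the domain of `∇₀^*`. -/
def diffusionOp (p : EuclideanSpace ℝ (Fin n) → ℝ) : L2 Ω →ₗ.[ℂ] L2 Ω :=
  compOp (grad0Adj Ω) (compOp (mulOpVec Ω fun x => 1 / p x) (gradW10 Ω))

variable {Ω} in
/-- The operator `Â (u, q) = (∇₀^* q, ∇_w u - p q)` in `L²(Ω) × (L²(Ω))ⁿ` with domain
`W¹₀(Ω) × D(∇₀^*)`. -/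
def firstOrderOp (p : EuclideanSpace ℝ (Fin n) → ℝ) (hp : MemLp p ∞ (leb Ω)) :
    L2xL2n Ω →ₗ.[ℂ] L2xL2n Ω where
  domain :=
    { carrier := {w | w.fst ∈ W10 Ω ∧ w.snd ∈ (grad0Adj Ω).domain}
      zero_mem' := ⟨zero_mem _, zero_mem _⟩
      add_mem' := fun hv hw => ⟨add_mem hv.1 hw.1, add_mem hv.2 hw.2⟩
      smul_mem' := fun a _ hw => ⟨Submodule.smul_mem _ a hw.1, Submodule.smul_mem _ a hw.2⟩ }
  toFun :=
    { toFun := fun w => WithLp.toLp 2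
        (grad0Adj Ω ⟨(w : L2xL2n Ω).snd, w.2.2⟩,
          gradW10 Ω ⟨(w : L2xL2n Ω).fst, w.2.1⟩ - mulVec p hp (w : L2xL2n Ω).snd)
      map_add' := fun v w => by
        have h1 : grad0Adj Ω ⟨((v + w : _) : L2xL2n Ω).snd, (v + w).2.2⟩ =
            grad0Adj Ω ⟨(v : L2xL2n Ω).snd, v.2.2⟩ + grad0Adj Ω ⟨(w : L2xL2n Ω).snd, w.2.2⟩ :=
          (grad0Adj Ω).map_add ⟨(v : L2xL2n Ω).snd, v.2.2⟩ ⟨(w : L2xL2n Ω).snd, w.2.2⟩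
        have h2 : gradW10 Ω ⟨((v + w : _) : L2xL2n Ω).fst, (v + w).2.1⟩ =
            gradW10 Ω ⟨(v : L2xL2n Ω).fst, v.2.1⟩ + gradW10 Ω ⟨(w : L2xL2n Ω).fst, w.2.1⟩ :=
          (gradW10 Ω).map_add ⟨(v : L2xL2n Ω).fst, v.2.1⟩ ⟨(w : L2xL2n Ω).fst, w.2.1⟩
        have h3 : mulVec p hp ((v + w : _) : L2xL2n Ω).snd =
            mulVec p hp (v : L2xL2n Ω).snd + mulVec p hp (w : L2xL2n Ω).snd :=
          (mulVec p hp).map_add _ _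
        rw [h1, h2, h3, add_sub_add_comm, ← Prod.mk_add_mk, WithLp.toLp_add]
      map_smul' := fun a w => by
        have h1 : grad0Adj Ω ⟨((a • w : _) : L2xL2n Ω).snd, (a • w).2.2⟩ =
            a • grad0Adj Ω ⟨(w : L2xL2n Ω).snd, w.2.2⟩ :=
          (grad0Adj Ω).map_smul a ⟨(w : L2xL2n Ω).snd, w.2.2⟩
        have h2 : gradW10 Ω ⟨((a • w : _) : L2xL2n Ω).fst, (a • w).2.1⟩ =
            a • gradW10 Ω ⟨(w : L2xL2n Ω).fst, w.2.1⟩ :=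
          (gradW10 Ω).map_smul a ⟨(w : L2xL2n Ω).fst, w.2.1⟩
        have h3 : mulVec p hp ((a • w : _) : L2xL2n Ω).snd =
            a • mulVec p hp (w : L2xL2n Ω).snd := (mulVec p hp).map_smul _ _
        rw [h1, h2, h3, ← smul_sub, ← Prod.smul_mk, WithLp.toLp_smul, RingHom.id_apply] }

end Diffusion

end

open Diffusion

namespace Diffusion

/-! Write `M` for multiplication by `1 / (p + l)` and Γ for the graph of the weak gradient on W¹₀, a
closed subspace of L² × (L²)ⁿ (`mem_gradGraph_iff`). Both resolvents come from one variational
problem: given (f, h), find (u, ∇u) in Γ with ⟪∇v, M∇u - h⟫ = ⟪v, f + l u⟫ for all (v, ∇v) in Γ.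
Since `M ≥ 1 / (C₂ + l)` and c‖u‖ ≤ ‖∇u‖, the form is coercive on Γ as soon as l < c² / (C₂ + l),
which follows from the bound on l. Lax-Milgram then gives a bounded solution operator `E : (f, h) ↦
(u, ∇u)` (`exists_isWeakSolution_iff`).

With h = 0 the problem says (A - l)u = f, where A is the diffusion operator with coefficient p + l.
For (Â - l)(u, q) = (f, g), the second row gives q = M(∇u - g); inserting this in the first row
leaves the same problem with h = Mg. So (u, ∇u) = E(f, Mg).

The operators in the formula are the four blocks of `E`. Its second column consists of the closures
because E(∇₀^* q, 0) = E(0, q) on the dense domain of ∇₀^* (`weakSolution_grad0Adj`,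
`closure_eq_of_dense_domain`). The block formula for the resolvent is then linearity of `E`. -/

open scoped InnerProductSpace in
/-- Lax-Milgram on a closed subspace: the problem `⟪v, B x⟫ = ⟪v, w⟫` for all `v ∈ Γ` has a unique
solution `x ∈ Γ`, and it depends continuously on `w`. -/
theorem exists_solution_of_coercive {X : Type*} [NormedAddCommGroup X] [InnerProductSpace ℂ X]
    [CompleteSpace X] (Γ : Submodule ℂ X) (hΓ : IsClosed (Γ : Set X)) (B : X →L[ℂ] X)
    {δ : ℝ} (hδ : 0 < δ) (hB : ∀ w ∈ Γ, δ * ‖w‖ ^ 2 ≤ (⟪w, B w⟫_ℂ).re) :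
    ∃ E : X →L[ℂ] X, (∀ w, E w ∈ Γ ∧ ∀ v ∈ Γ, ⟪v, B (E w)⟫_ℂ = ⟪v, w⟫_ℂ) ∧
      ∀ w, ∀ x ∈ Γ, (∀ v ∈ Γ, ⟪v, B x⟫_ℂ = ⟪v, w⟫_ℂ) → x = E w := by
  have : CompleteSpace Γ := hΓ.completeSpace_coe
  -- Testing against Γ only sees projections to Γ, so the problem is `S x = P w` for the compression
  -- `S` of `B` and the projection `P`; coercivity makes `S` invertible.
  set S : Γ →L[ℂ] Γ := Γ.orthogonalProjectionOnto ∘L B ∘L Γ.subtypeL with hS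
  have key : ∀ (v : Γ) (w : X), ⟪v, Γ.orthogonalProjectionOnto w⟫_ℂ = ⟪(v : X), w⟫_ℂ := fun v w =>
    Submodule.inner_orthogonalProjectionOnto_eq_of_mem_left v w
  have hunit : IsUnit S := by
    refine ContinuousLinearMap.isUnit_of_forall_le_norm_inner_map S (c := ⟨δ, hδ.le⟩) hδ fun x => ?_
    rw [norm_inner_symm, hS]
    simp only [ContinuousLinearMap.comp_apply, key]
    refine le_trans ?_ (Complex.re_le_norm _)
    have := hB x x.2
    rw [mul_comm]
    exact this
  obtain ⟨U, hU⟩ := hunit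
  have hU1 : ∀ y, S ((U⁻¹ : (Γ →L[ℂ] Γ)ˣ).1 y) = y := fun y => by
    rw [← hU]
    exact congrArg (fun F : Γ →L[ℂ] Γ => F y) U.mul_inv
  have hU2 : ∀ y, (U⁻¹ : (Γ →L[ℂ] Γ)ˣ).1 (S y) = y := fun y => by
    rw [← hU]
    exact congrArg (fun F : Γ →L[ℂ] Γ => F y) U.inv_mul
  refine ⟨Γ.subtypeL ∘L (U⁻¹ : (Γ →L[ℂ] Γ)ˣ).1 ∘L Γ.orthogonalProjectionOnto, fun w => ⟨?_, ?_⟩, ?_⟩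
  · exact Subtype.property _
  · intro v hv
    have h := congrArg (fun z : Γ => ⟪(⟨v, hv⟩ : Γ), z⟫_ℂ) (hU1 (Γ.orthogonalProjectionOnto w))
    simp only [hS, ContinuousLinearMap.comp_apply, key] at h
    exact h
  · intro w x hx h
    have h1 : S ⟨x, hx⟩ = Γ.orthogonalProjectionOnto w := by
      refine ext_inner_left ℂ fun v => ?_
      simp only [hS, ContinuousLinearMap.comp_apply, key]
      exact h v v.2
    have h2 := hU2 ⟨x, hx⟩
    rw [h1] at h2
    exact (congrArg Subtype.val h2).symm

/-! ### Closures and compositions of partially defined operators -/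

section Restriction

variable {X Y : Type*} [NormedAddCommGroup X] [NormedSpace ℂ X]
  [NormedAddCommGroup Y] [NormedSpace ℂ Y]

/-- An operator that agrees with a bounded operator on a dense domain is closable, with that
bounded operator as its closure. -/
theorem closure_eq_of_dense_domain (T : X →ₗ.[ℂ] Y) (hT : Dense (T.domain : Set X))
    (S : X →L[ℂ] Y) (h : ∀ x : T.domain, T x = S x) :
    T.IsClosable ∧ T.closure = S.toLinearMap.toPMap ⊤ := by
  -- The graph of the bounded `S` is closed, which gives ≤; density of the domain and continuity of
  -- x ↦ (x, S x) give ≥.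
  have hcl : T.graph.topologicalClosure = (S.toLinearMap.toPMap ⊤).graph := by
    apply le_antisymm
    · refine Submodule.topologicalClosure_minimal _ ?_ ?_
      · intro z hz
        obtain ⟨x, hx⟩ := (LinearPMap.mem_graph_iff _).1 hz
        refine (LinearPMap.mem_graph_iff _).2 ⟨⟨z.1, trivial⟩, rfl, ?_⟩
        rw [← hx.2, h x, hx.1]
        rfl
      · have : ((S.toLinearMap.toPMap ⊤).graph : Set (X × Y)) = {z | S z.1 = z.2} := by
          ext z
          refine ⟨fun hz => ?_, fun hz => ?_⟩
          · obtain ⟨x, hx⟩ := (LinearPMap.mem_graph_iff _).1 hz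
            change S z.1 = z.2
            rw [← hx.2, ← hx.1]
            rfl
          · exact (LinearPMap.mem_graph_iff _).2 ⟨⟨z.1, trivial⟩, rfl, hz⟩
        rw [this]
        exact isClosed_eq (S.continuous.comp continuous_fst) continuous_snd
    · intro z hz
      obtain ⟨x, hx⟩ := (LinearPMap.mem_graph_iff _).1 hz
      have hz' : z = ((x : X), S x) := Prod.ext hx.1.symm hx.2.symm
      rw [hz']
      have hc : Continuous fun x : X => (x, S x) := continuous_id.prodMk S.continuous
      refine map_mem_closure (f := fun x : X => (x, S x)) hc (hT (x : X)) fun y hy => ?_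
      exact (LinearPMap.mem_graph_iff _).2 ⟨⟨y, hy⟩, rfl, h ⟨y, hy⟩⟩
  have hc : T.IsClosable := ⟨_, hcl⟩
  refine ⟨hc, LinearPMap.eq_of_eq_graph ?_⟩
  rw [← hc.graph_closure_eq_closure_graph, hcl]

theorem compOp_eq_toPMap {Z : Type*} [NormedAddCommGroup Z] [NormedSpace ℂ Z]
    (S : Y →ₗ.[ℂ] Z) (R : X →L[ℂ] Y) (G : X →L[ℂ] Z)
    (h : ∀ x, ∃ hx : R x ∈ S.domain, S ⟨R x, hx⟩ = G x) :
    compOp S (R.toLinearMap.toPMap ⊤) = G.toLinearMap.toPMap ⊤ := by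
  refine LinearPMap.ext ?_ ?_
  · refine le_antisymm le_top fun x _ => ?_
    exact ⟨⟨x, trivial⟩, (h x).1, rfl⟩
  · intro x hx hx'
    exact (h x).2

end Restriction

/-! ### Test functions and weak derivatives -/

variable {n : ℕ} {Ω : Opens (EuclideanSpace ℝ (Fin n))}

open scoped InnerProductSpace

theorem inner_testToL2_left (φ : 𝓓(Ω, ℂ)) (f : L2 Ω) :
    ⟪testToL2 Ω φ, f⟫_ℂ = ∫ x in (Ω : Set _), f x * (starRingEnd ℂ) (φ x) := by
  rw [L2.inner_def]
  refine integral_congr_ae ?_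
  filter_upwards [(memLp_test Ω φ).coeFn_toLp] with x hx
  change ⟪(memLp_test Ω φ).toLp φ x, f x⟫_ℂ = _
  rw [hx]
  rfl

/-- By the fundamental lemma of the calculus of variations, a function orthogonal to all test
functions vanishes a.e.; real test functions suffice for this. -/
theorem dense_testSpace : Dense (testSpace Ω : Set (L2 Ω)) := by
  rw [Submodule.dense_iff_topologicalClosure_eq_top,
    Submodule.topologicalClosure_eq_top_iff, Submodule.eq_bot_iff]
  intro f hf
  have hloc : LocallyIntegrableOn (f : _ → ℂ) (Ω : Set (EuclideanSpace ℝ (Fin n))) volume :=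
    locallyIntegrableOn_of_locallyIntegrable_restrict
      ((Lp.memLp f).locallyIntegrable one_le_two)
  have h0 := Ω.isOpen.ae_eq_zero_of_integral_contDiff_smul_eq_zero hloc ?_
  · refine Lp.ext ?_
    filter_upwards [(ae_restrict_iff' Ω.isOpen.measurableSet).2 h0, Lp.coeFn_zero ℂ 2 (leb Ω)]
      with x h1 h2
    rw [h1, h2, Pi.zero_apply]
  · intro g hg hgc hgs
    let φ : 𝓓(Ω, ℂ) := ⟨fun x => (g x : ℂ), Complex.ofRealCLM.contDiff.comp hg,
      hgc.comp_left Complex.ofReal_zero, (tsupport_comp_subset Complex.ofReal_zero g).trans hgs⟩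
    have h1 := (Submodule.mem_orthogonal _ _).1 hf (testToL2 Ω φ) ⟨φ, rfl⟩
    rw [inner_testToL2_left] at h1
    rw [← h1, ← setIntegral_eq_integral_of_forall_compl_eq_zero (s := (Ω : Set _))]
    · refine integral_congr_ae (Filter.Eventually.of_forall fun x => ?_)
      change g x • f x = f x * (starRingEnd ℂ) (g x : ℂ)
      rw [Complex.conj_ofReal, Complex.real_smul, mul_comm]
    · intro x hx
      rw [image_eq_zero_of_notMem_tsupport fun h => hx (hgs h), zero_smul]

theorem classicalDeriv_apply (j : Fin n) (φ : 𝓓(Ω, ℂ)) (h) :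
    classicalDeriv Ω j ⟨testToL2 Ω φ, h⟩ = testToL2 Ω (testDeriv Ω j φ) := by
  have h1 : (testEquiv Ω).symm ⟨testToL2 Ω φ, h⟩ = φ := (testEquiv Ω).symm_apply_apply φ
  change testToL2 Ω (testDeriv Ω j ((testEquiv Ω).symm ⟨testToL2 Ω φ, h⟩)) = _
  rw [h1]

/-- Integration by parts over the whole space: compact support in Ω leaves no boundary term. -/
theorem inner_testDeriv (j : Fin n) (φ ψ : 𝓓(Ω, ℂ)) :
    ⟪testToL2 Ω (testDeriv Ω j φ), testToL2 Ω ψ⟫_ℂ =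
      -⟪testToL2 Ω φ, testToL2 Ω (testDeriv Ω j ψ)⟫_ℂ := by
  have hint : ∀ φ ψ : 𝓓(Ω, ℂ), ⟪testToL2 Ω φ, testToL2 Ω ψ⟫_ℂ =
      ∫ x, (starRingEnd ℂ) (φ x) * ψ x := by
    intro φ ψ
    have hz : ∀ x, x ∉ (Ω : Set _) → (starRingEnd ℂ) (φ x) * ψ x = 0 := by
      intro x hx
      rw [image_eq_zero_of_notMem_tsupport fun h => hx (ψ.tsupport_subset h), mul_zero]
    rw [inner_testToL2_left, ← setIntegral_eq_integral_of_forall_compl_eq_zero hz]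
    refine integral_congr_ae ?_
    filter_upwards [(memLp_test Ω ψ).coeFn_toLp] with x hx
    change (memLp_test Ω ψ).toLp ψ x * _ = _
    rw [hx, mul_comm]
  have hcs : ∀ φ : 𝓓(Ω, ℂ), ContDiff ℝ ((⊤ : ℕ∞) : WithTop ℕ∞) fun x => (starRingEnd ℂ) (φ x) :=
    fun φ => Complex.conjCLE.contDiff.comp φ.contDiff
  have hI : ∀ φ ψ : 𝓓(Ω, ℂ), Integrable fun x => (starRingEnd ℂ) (φ x) * ψ x := fun φ ψ =>
    ((hcs φ).continuous.mul ψ.continuous).integrable_of_hasCompactSupport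
      ψ.hasCompactSupport.mul_left
  have hd : ∀ (φ : 𝓓(Ω, ℂ)) x, DifferentiableAt ℝ φ x := fun φ x =>
    (φ.contDiff.differentiable (by simp)).differentiableAt
  have hconj : ∀ x, fderiv ℝ (fun x => (starRingEnd ℂ) (φ x)) x (EuclideanSpace.single j 1) =
      (starRingEnd ℂ) (testDeriv Ω j φ x) := by
    intro x
    have h1 : HasFDerivAt (fun x => (starRingEnd ℂ) (φ x))
        ((Complex.conjCLE : ℂ →L[ℝ] ℂ) ∘L fderiv ℝ φ x) x :=
      (Complex.conjCLE : ℂ →L[ℝ] ℂ).hasFDerivAt.comp x (hd φ x).hasFDerivAt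
    rw [h1.fderiv, testDeriv_apply]
    rfl
  rw [hint, hint]
  have := integral_mul_fderiv_eq_neg_fderiv_mul_of_integrable (μ := volume)
    (f := fun x => (starRingEnd ℂ) (φ x)) (g := ψ) (v := EuclideanSpace.single j (1 : ℝ))
    ?_ ?_ (hI φ ψ) (fun x _ => (hcs φ).differentiable (by simp) x)
    (fun x _ => hd ψ x)
  · simp only [hconj, ← testDeriv_apply] at this
    rw [this, neg_neg]
  · simp only [hconj]
    exact hI (testDeriv Ω j φ) ψ
  · simp only [← testDeriv_apply]
    exact hI φ (testDeriv Ω j ψ)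

theorem testToL2_mem (φ : 𝓓(Ω, ℂ)) : testToL2 Ω φ ∈ testSpace Ω := ⟨φ, rfl⟩

/-- Domain membership and value together become one condition that is closed in (u, g), hence stable
under limits. -/
theorem exists_weakDeriv_eq_iff (j : Fin n) (u g : L2 Ω) :
    (∃ h : u ∈ (weakDeriv Ω j).domain, weakDeriv Ω j ⟨u, h⟩ = g) ↔
      ∀ ψ : 𝓓(Ω, ℂ), ⟪g, testToL2 Ω ψ⟫_ℂ = -⟪u, testToL2 Ω (testDeriv Ω j ψ)⟫_ℂ := by
  have hd : Dense ((classicalDeriv Ω j).domain : Set (L2 Ω)) := dense_testSpace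
  constructor
  · rintro ⟨h, rfl⟩ ψ
    have h' : u ∈ (classicalDeriv Ω j).adjoint.domain := h
    have hψ : testToL2 Ω ψ ∈ (classicalDeriv Ω j).domain := testToL2_mem ψ
    have h1 := LinearPMap.adjoint_isFormalAdjoint hd ⟨u, h'⟩ ⟨testToL2 Ω ψ, hψ⟩
    rw [classicalDeriv_apply] at h1
    rw [← h1]
    change ⟪-(classicalDeriv Ω j).adjoint ⟨u, h'⟩, _⟫_ℂ = _
    rw [inner_neg_left]
  · intro h
    have hx : ∀ x : (classicalDeriv Ω j).domain, ⟪-g, (x : L2 Ω)⟫_ℂ = ⟪u, classicalDeriv Ω j x⟫_ℂ := by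
      rintro ⟨x, hx⟩
      obtain ⟨ψ, rfl⟩ := id hx
      rw [classicalDeriv_apply, inner_neg_left, h ψ, neg_neg]
    have hu : u ∈ (classicalDeriv Ω j).adjoint.domain :=
      LinearPMap.mem_adjoint_domain_of_exists u ⟨-g, hx⟩
    refine ⟨hu, ?_⟩
    change -(classicalDeriv Ω j).adjoint ⟨u, hu⟩ = g
    rw [LinearPMap.adjoint_apply_eq hd ⟨u, hu⟩ hx, neg_neg]

theorem testSpace_le_W1 : testSpace Ω ≤ W1 Ω := by
  rintro _ ⟨φ, rfl⟩
  refine (Submodule.mem_iInf _).2 fun j => ?_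
  exact ((exists_weakDeriv_eq_iff j _ _).2 (inner_testDeriv j φ)).1

theorem grad0_apply (j : Fin n) (φ : 𝓓(Ω, ℂ)) (h) :
    (grad0 Ω ⟨testToL2 Ω φ, h⟩) j = testToL2 Ω (testDeriv Ω j φ) :=
  classicalDeriv_apply j φ h

theorem gradW_testToL2 (φ : 𝓓(Ω, ℂ)) (h : testToL2 Ω φ ∈ W1 Ω) (h') :
    gradW Ω ⟨testToL2 Ω φ, h⟩ = grad0 Ω ⟨testToL2 Ω φ, h'⟩ := by
  refine PiLp.ext fun j => ?_
  rw [grad0_apply]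
  exact ((exists_weakDeriv_eq_iff j _ _).2 (inner_testDeriv j φ)).2

/-! ### The graph of the gradient on W¹₀ and the adjoint ∇₀^* -/

variable (Ω) in
/-- The graph of `gradW10`, as a subspace of `L²(Ω) × (L²(Ω))ⁿ`. -/
noncomputable def gradGraph : Submodule ℂ (L2xL2n Ω) :=
  ((testSpace Ω).comap (W1 Ω).subtype |>.map (W1Embedding Ω)).topologicalClosure

theorem isClosed_gradGraph : IsClosed (gradGraph Ω : Set (L2xL2n Ω)) :=
  Submodule.isClosed_topologicalClosure _

theorem continuous_fst_L2xL2n : Continuous fun w : L2xL2n Ω => w.fst :=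
  continuous_fst.comp (WithLp.prod_continuous_ofLp 2 _ _)

theorem continuous_snd_L2xL2n : Continuous fun w : L2xL2n Ω => w.snd :=
  continuous_snd.comp (WithLp.prod_continuous_ofLp 2 _ _)

theorem gradGraph_induction {P : L2xL2n Ω → Prop} (hP : IsClosed {w | P w})
    (h : ∀ (φ : 𝓓(Ω, ℂ)) (hφ : testToL2 Ω φ ∈ (grad0 Ω).domain),
      P (WithLp.toLp 2 (testToL2 Ω φ, grad0 Ω ⟨testToL2 Ω φ, hφ⟩)))
    {w : L2xL2n Ω} (hw : w ∈ gradGraph Ω) : P w := by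
  refine closure_minimal (fun w hw => ?_) hP hw
  obtain ⟨⟨_, hu⟩, ⟨φ, rfl⟩, rfl⟩ := hw
  have hφ : testToL2 Ω φ ∈ (grad0 Ω).domain := testToL2_mem φ
  have := h φ hφ
  rw [← gradW_testToL2 φ hu] at this
  exact this

theorem testToL2_mem_gradGraph (φ : 𝓓(Ω, ℂ)) (hφ : testToL2 Ω φ ∈ (grad0 Ω).domain) :
    WithLp.toLp 2 (testToL2 Ω φ, grad0 Ω ⟨testToL2 Ω φ, hφ⟩) ∈ gradGraph Ω := by
  refine Submodule.le_topologicalClosure _ ?_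
  refine ⟨⟨testToL2 Ω φ, testSpace_le_W1 ⟨φ, rfl⟩⟩, ⟨φ, rfl⟩, ?_⟩
  rw [← gradW_testToL2 φ (testSpace_le_W1 ⟨φ, rfl⟩)]
  rfl

/-- The weak gradient is a closed operator: the identity defining it passes to limits of test
functions, so the closure taken in the product space is still a graph. -/
theorem mem_gradGraph_iff (w : L2xL2n Ω) :
    w ∈ gradGraph Ω ↔ ∃ h : w.fst ∈ W10 Ω, gradW10 Ω ⟨w.fst, h⟩ = w.snd := by
  constructor
  · intro hw
    have h1 : ∀ j, ∃ h : w.fst ∈ (weakDeriv Ω j).domain,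
        weakDeriv Ω j ⟨w.fst, h⟩ = w.snd j := by
      intro j
      rw [exists_weakDeriv_eq_iff]
      intro ψ
      refine gradGraph_induction (P := fun w => ⟪w.snd j, testToL2 Ω ψ⟫_ℂ =
        -⟪w.fst, testToL2 Ω (testDeriv Ω j ψ)⟫_ℂ) ?_ ?_ hw
      · refine isClosed_eq ?_ ?_
        · exact ((PiLp.continuous_apply 2 _ j).comp continuous_snd_L2xL2n).inner continuous_const
        · exact (continuous_fst_L2xL2n.inner continuous_const).neg
      · intro φ hφ
        change ⟪(grad0 Ω ⟨testToL2 Ω φ, hφ⟩) j, _⟫_ℂ = -⟪testToL2 Ω φ, _⟫_ℂ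
        rw [grad0_apply]
        exact inner_testDeriv j φ ψ
    have h2 : w.fst ∈ W1 Ω := (Submodule.mem_iInf _).2 fun j => (h1 j).1
    have h3 : gradW Ω ⟨w.fst, h2⟩ = w.snd := PiLp.ext fun j => (h1 j).2
    have h4 : W1Embedding Ω ⟨w.fst, h2⟩ = w := by
      change WithLp.toLp 2 (w.fst, gradW Ω ⟨w.fst, h2⟩) = w
      rw [h3]
      rfl
    refine ⟨⟨⟨w.fst, h2⟩, ?_, rfl⟩, h3⟩
    change W1Embedding Ω ⟨w.fst, h2⟩ ∈ gradGraph Ω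
    rwa [h4]
  · rintro ⟨⟨⟨u, hu⟩, hu', hw⟩, h⟩
    have h5 : W1Embedding Ω ⟨u, hu⟩ = w := by
      change WithLp.toLp 2 (u, gradW Ω ⟨u, hu⟩) = w
      change u = w.fst at hw
      subst hw
      change gradW Ω ⟨w.fst, hu⟩ = w.snd at h
      rw [h]
      rfl
    rw [← h5]
    exact hu'

/-- The adjoint identity is continuous in (v, ∇v), so it extends from test functions to W¹₀. Thus
equations for ∇₀^* may be tested in the same space in which solutions are sought. -/
theorem exists_grad0Adj_eq_iff (q : L2n Ω) (f : L2 Ω) :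
    (∃ h : q ∈ (grad0Adj Ω).domain, grad0Adj Ω ⟨q, h⟩ = f) ↔
      ∀ v ∈ gradGraph Ω, ⟪v.snd, q⟫_ℂ = ⟪v.fst, f⟫_ℂ := by
  have hd : Dense ((grad0 Ω).domain : Set (L2 Ω)) := dense_testSpace
  constructor
  · rintro ⟨h, rfl⟩ v hv
    refine gradGraph_induction
      (P := fun v => ⟪v.snd, q⟫_ℂ = ⟪v.fst, grad0Adj Ω ⟨q, h⟩⟫_ℂ) ?_ ?_ hv
    · exact isClosed_eq (continuous_snd_L2xL2n.inner continuous_const)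
        (continuous_fst_L2xL2n.inner continuous_const)
    · intro φ hφ
      have := LinearPMap.adjoint_isFormalAdjoint hd ⟨q, h⟩ ⟨testToL2 Ω φ, hφ⟩
      have := congrArg (starRingEnd ℂ) this
      rw [inner_conj_symm, inner_conj_symm] at this
      exact this.symm
  · intro h
    have hx : ∀ x : (grad0 Ω).domain, ⟪f, (x : L2 Ω)⟫_ℂ = ⟪q, grad0 Ω x⟫_ℂ := by
      rintro ⟨_, φ, rfl⟩
      have := congrArg (starRingEnd ℂ) (h _ (testToL2_mem_gradGraph φ ⟨φ, rfl⟩))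
      rw [inner_conj_symm, inner_conj_symm] at this
      exact this.symm
    have hq : q ∈ (grad0 Ω).adjoint.domain := LinearPMap.mem_adjoint_domain_of_exists q ⟨f, hx⟩
    exact ⟨hq, LinearPMap.adjoint_apply_eq hd ⟨q, hq⟩ hx⟩

theorem single_mem_grad0Adj_domain (j : Fin n) (φ : 𝓓(Ω, ℂ)) :
    (WithLp.toLp 2 (Pi.single j (testToL2 Ω φ)) : L2n Ω) ∈ (grad0Adj Ω).domain := by
  refine LinearPMap.mem_adjoint_domain_of_exists _ ⟨-testToL2 Ω (testDeriv Ω j φ), ?_⟩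
  rintro ⟨x, hx⟩
  obtain ⟨ψ, rfl⟩ := id hx
  rw [inner_neg_left, inner_testDeriv, neg_neg, PiLp.inner_apply,
    Finset.sum_eq_single j]
  · rw [grad0_apply]
    simp
  · intro i _ hi
    simp [Pi.single_eq_of_ne hi]
  · simp

/-- The domain contains the fields whose only nonzero component is a test function, so density
reduces to `dense_testSpace` in each component. -/
theorem dense_grad0Adj_domain : Dense ((grad0Adj Ω).domain : Set (L2n Ω)) := by
  rw [Submodule.dense_iff_topologicalClosure_eq_top,
    Submodule.topologicalClosure_eq_top_iff, Submodule.eq_bot_iff]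
  intro q hq
  refine PiLp.ext fun j => ?_
  have h1 : q j ∈ (testSpace Ω)ᗮ := by
    rw [Submodule.mem_orthogonal]
    rintro _ ⟨φ, rfl⟩
    have := (Submodule.mem_orthogonal _ _).1 hq _ (single_mem_grad0Adj_domain j φ)
    rw [PiLp.inner_apply, Finset.sum_eq_single j] at this
    · simpa using this
    · intro i _ hi
      simp [Pi.single_eq_of_ne hi]
    · simp
  have h2 := Submodule.topologicalClosure_eq_top_iff.1
    (Submodule.dense_iff_topologicalClosure_eq_top.1 (dense_testSpace (Ω := Ω)))
  rw [h2] at h1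
  exact h1

/-! ### Bounded multiplication operators -/

theorem mulVec_apply_ae (m : EuclideanSpace ℝ (Fin n) → ℝ) (hm : MemLp m ∞ (leb Ω)) (q : L2n Ω)
    (i : Fin n) : (mulVec m hm q) i =ᵐ[leb Ω] fun x => (m x : ℂ) * q i x :=
  MemLp.coeFn_toLp ((Submodule.mem_iInf _).1 (mulOpVec_domain hm q) i)

theorem norm_mulVec_le (m : EuclideanSpace ℝ (Fin n) → ℝ) (hm : MemLp m ∞ (leb Ω)) {C : ℝ}
    (hC : 0 ≤ C) (h : ∀ᵐ x ∂(leb Ω), |m x| ≤ C) (q : L2n Ω) : ‖mulVec m hm q‖ ≤ C * ‖q‖ := by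
  refine le_of_sq_le_sq ?_ (by positivity)
  rw [mul_pow, PiLp.norm_sq_eq_of_L2, PiLp.norm_sq_eq_of_L2, Finset.mul_sum]
  refine Finset.sum_le_sum fun i _ => ?_
  rw [← mul_pow]
  refine pow_le_pow_left₀ (norm_nonneg _) (Lp.norm_le_mul_norm_of_ae_le_mul ?_) 2
  filter_upwards [h, mulVec_apply_ae m hm q i] with x h1 h2
  rw [h2, norm_mul, Complex.norm_real, Real.norm_eq_abs]
  gcongr

theorem le_re_inner_mulVec (m : EuclideanSpace ℝ (Fin n) → ℝ) (hm : MemLp m ∞ (leb Ω)) {a : ℝ}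
    (h : ∀ᵐ x ∂(leb Ω), a ≤ m x) (q : L2n Ω) : a * ‖q‖ ^ 2 ≤ (⟪q, mulVec m hm q⟫_ℂ).re := by
  rw [PiLp.norm_sq_eq_of_L2, PiLp.inner_apply, Complex.re_sum, Finset.mul_sum]
  refine Finset.sum_le_sum fun i _ => ?_
  rw [← inner_self_eq_norm_sq (𝕜 := ℂ), L2.inner_def, L2.inner_def]
  change a * (∫ x, ⟪q i x, q i x⟫_ℂ ∂(leb Ω)).re ≤ (∫ x, ⟪q i x, mulVec m hm q i x⟫_ℂ ∂(leb Ω)).re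
  have h1 := L2.integrable_inner (𝕜 := ℂ) (q i) (q i)
  have h2 := L2.integrable_inner (𝕜 := ℂ) (q i) (mulVec m hm q i)
  have e1 := integral_re h1
  have e2 := integral_re h2
  change _ = (_ : ℂ).re at e1
  change _ = (_ : ℂ).re at e2
  rw [← e1, ← e2, ← integral_const_mul]
  refine integral_mono_ae (h1.re.const_mul a) h2.re ?_
  filter_upwards [h, mulVec_apply_ae m hm q i] with x hx h3
  rw [h3]
  simp only [RCLike.inner_apply, RCLike.re_to_complex, Complex.mul_conj, mul_assoc,
    Complex.re_ofReal_mul, Complex.ofReal_re]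
  exact mul_le_mul_of_nonneg_right hx (Complex.normSq_nonneg _)

theorem mulVec_mulVec (m m' : EuclideanSpace ℝ (Fin n) → ℝ) (hm : MemLp m ∞ (leb Ω))
    (hm' : MemLp m' ∞ (leb Ω)) (h : ∀ᵐ x ∂(leb Ω), m x * m' x = 1) (q : L2n Ω) :
    mulVec m hm (mulVec m' hm' q) = q := by
  refine PiLp.ext fun i => Lp.ext ?_
  filter_upwards [h, mulVec_apply_ae m hm (mulVec m' hm' q) i, mulVec_apply_ae m' hm' q i]
    with x h1 h2 h3
  rw [h2, h3, ← mul_assoc, ← Complex.ofReal_mul, h1, Complex.ofReal_one, one_mul]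

theorem mulVec_add_const (m : EuclideanSpace ℝ (Fin n) → ℝ) (l : ℝ) (hm : MemLp m ∞ (leb Ω))
    (hm' : MemLp (fun x => m x + l) ∞ (leb Ω)) (q : L2n Ω) :
    mulVec (fun x => m x + l) hm' q = mulVec m hm q + (l : ℂ) • q := by
  refine PiLp.ext fun i => Lp.ext ?_
  rw [PiLp.add_apply, PiLp.smul_apply]
  filter_upwards [mulVec_apply_ae m hm q i, mulVec_apply_ae _ hm' q i,
    Lp.coeFn_add (mulVec m hm q i) ((l : ℂ) • q i), Lp.coeFn_smul (l : ℂ) (q i)] with x h1 h2 h3 h4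
  rw [h2, h3, Pi.add_apply, h1, h4, Pi.smul_apply, smul_eq_mul, Complex.ofReal_add, add_mul]

/-! ### Weak form of the operator equations -/

theorem exists_compOp_eq_iff {X Y Z : Type*} [NormedAddCommGroup X] [NormedSpace ℂ X]
    [NormedAddCommGroup Y] [NormedSpace ℂ Y] [NormedAddCommGroup Z] [NormedSpace ℂ Z]
    (S : Y →ₗ.[ℂ] Z) (T : X →ₗ.[ℂ] Y) (x : X) (z : Z) :
    (∃ h : x ∈ (compOp S T).domain, compOp S T ⟨x, h⟩ = z) ↔
      ∃ (hx : x ∈ T.domain) (hy : T ⟨x, hx⟩ ∈ S.domain), S ⟨T ⟨x, hx⟩, hy⟩ = z := by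
  constructor
  · rintro ⟨h, rfl⟩
    obtain ⟨⟨y, hy⟩, hy', rfl⟩ := id h
    exact ⟨hy, hy', rfl⟩
  · rintro ⟨hx, hy, rfl⟩
    exact ⟨⟨⟨x, hx⟩, hy, rfl⟩, rfl⟩

theorem exists_diffusionOp_eq_iff (p : EuclideanSpace ℝ (Fin n) → ℝ)
    (hm : MemLp (fun x => 1 / p x) ∞ (leb Ω)) (u f : L2 Ω) :
    (∃ h : u ∈ (diffusionOp Ω p).domain, diffusionOp Ω p ⟨u, h⟩ = f) ↔
      ∃ q : L2n Ω, WithLp.toLp 2 (u, q) ∈ gradGraph Ω ∧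
        ∀ v ∈ gradGraph Ω, ⟪v.snd, mulVec (fun x => 1 / p x) hm q⟫_ℂ = ⟪v.fst, f⟫_ℂ := by
  rw [diffusionOp, exists_compOp_eq_iff]
  constructor
  · rintro ⟨hx, hy, h⟩
    obtain ⟨h1, h2, h3⟩ := (exists_compOp_eq_iff _ _ u _).1 ⟨hx, rfl⟩
    refine ⟨gradW10 Ω ⟨u, h1⟩, (mem_gradGraph_iff _).2 ⟨h1, rfl⟩, ?_⟩
    rw [← exists_grad0Adj_eq_iff]
    have h4 : mulVec (fun x => 1 / p x) hm (gradW10 Ω ⟨u, h1⟩) = _ := h3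
    simp only [h4]
    exact ⟨hy, h⟩
  · rintro ⟨q, hq, h⟩
    obtain ⟨h1, rfl⟩ : ∃ h1 : u ∈ W10 Ω, gradW10 Ω ⟨u, h1⟩ = q := (mem_gradGraph_iff _).1 hq
    rw [← exists_grad0Adj_eq_iff] at h
    obtain ⟨h3, h4⟩ := (exists_compOp_eq_iff (mulOpVec Ω fun x => 1 / p x) (gradW10 Ω) u
      (mulVec (fun x => 1 / p x) hm (gradW10 Ω ⟨u, h1⟩))).2 ⟨h1, mulOpVec_domain hm _, rfl⟩
    refine ⟨h3, ?_⟩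
    simp only [h4]
    exact h

theorem exists_firstOrderOp_eq_iff (p : EuclideanSpace ℝ (Fin n) → ℝ) (hp : MemLp p ∞ (leb Ω))
    (w z : L2xL2n Ω) :
    (∃ h : w ∈ (firstOrderOp p hp).domain, firstOrderOp p hp ⟨w, h⟩ = z) ↔
      WithLp.toLp 2 (w.fst, z.snd + mulVec p hp w.snd) ∈ gradGraph Ω ∧
        ∀ v ∈ gradGraph Ω, ⟪v.snd, w.snd⟫_ℂ = ⟪v.fst, z.fst⟫_ℂ := by
  rw [← exists_grad0Adj_eq_iff, mem_gradGraph_iff]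
  constructor
  · rintro ⟨h, rfl⟩
    exact ⟨⟨h.1, (sub_add_cancel _ _).symm⟩, ⟨h.2, rfl⟩⟩
  · rintro ⟨⟨h1, h2⟩, ⟨h3, h4⟩⟩
    refine ⟨⟨h1, h3⟩, ?_⟩
    change WithLp.toLp 2 (grad0Adj Ω ⟨w.snd, h3⟩, gradW10 Ω ⟨w.fst, h1⟩ - mulVec p hp w.snd) = z
    change gradW10 Ω ⟨w.fst, h1⟩ = _ at h2
    rw [h4, h2]
    change WithLp.toLp 2 (z.fst, z.snd + mulVec p hp w.snd - mulVec p hp w.snd) = z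
    rw [add_sub_cancel_right]
    rfl

/-! ### Coercivity and the solution operator -/

theorem exists_coercivity_constant {a c l : ℝ} (ha : 0 < a) (hc : 0 < c) (hl : l < a * c ^ 2) :
    ∃ δ > 0, ∀ s t : ℝ, 0 ≤ s → 0 ≤ t → c * s ≤ t →
      δ * (s ^ 2 + t ^ 2) ≤ a * t ^ 2 - l * s ^ 2 := by
  rcases lt_or_ge l 0 with h0 | h0
  · refine ⟨min (-l) a, lt_min (by linarith) ha, fun s t _ _ _ => ?_⟩
    nlinarith [mul_le_mul_of_nonneg_right (min_le_left (-l) a) (sq_nonneg s),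
      mul_le_mul_of_nonneg_right (min_le_right (-l) a) (sq_nonneg t)]
  · have hd : 0 < a - l / c ^ 2 := sub_pos.2 ((div_lt_iff₀ (by positivity)).2 hl)
    set d := a - l / c ^ 2 with hdef
    have hl' : l = (a - d) * c ^ 2 := by rw [hdef]; field_simp; ring
    have had : 0 ≤ a - d := by rw [hdef]; simp only [sub_sub_cancel]; positivity
    -- Since l = (a - d)c² and c²s² ≤ t², the right side is at least d t²; half of it is kept for t²
    -- and half is spent on c²s².
    refine ⟨min (d / 2 * c ^ 2) (d / 2), by positivity, fun s t hs ht hst => ?_⟩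
    have h1 : c ^ 2 * s ^ 2 ≤ t ^ 2 := by
      rw [← mul_pow]; exact pow_le_pow_left₀ (by positivity) hst 2
    have h2 := mul_le_mul_of_nonneg_right (min_le_left (d / 2 * c ^ 2) (d / 2)) (sq_nonneg s)
    have h3 := mul_le_mul_of_nonneg_right (min_le_right (d / 2 * c ^ 2) (d / 2)) (sq_nonneg t)
    have h4 := mul_le_mul_of_nonneg_left h1 had
    have h5 := mul_le_mul_of_nonneg_left h1 hd.le
    rw [hl']
    nlinarith

/-- `x = (u, ∇_w u)` with `u ∈ W¹₀(Ω)` solves `∇₀^* (M ∇_w u - h) - l u = f` weakly, where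
`w = (f, h)`. -/
def IsWeakSolution (M : L2n Ω →ₗ[ℂ] L2n Ω) (l : ℝ) (w x : L2xL2n Ω) : Prop :=
  x ∈ gradGraph Ω ∧ ∀ v ∈ gradGraph Ω,
    ⟪v.snd, M x.snd - w.snd⟫_ℂ = ⟪v.fst, w.fst + (l : ℂ) • x.fst⟫_ℂ

/-- Lax-Milgram applied to the block operator diag(-l, M) on the gradient graph. The equivalence
with `x = E w` carries existence and uniqueness at once. -/
theorem exists_isWeakSolution_iff (M : L2n Ω →ₗ[ℂ] L2n Ω) {C a c l : ℝ}
    (hM : ∀ q, ‖M q‖ ≤ C * ‖q‖) (ha : 0 < a) (hc : 0 < c)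
    (haM : ∀ q, a * ‖q‖ ^ 2 ≤ (⟪q, M q⟫_ℂ).re)
    (hP : ∀ w ∈ gradGraph Ω, c * ‖w.fst‖ ≤ ‖w.snd‖) (hl : l < a * c ^ 2) :
    ∃ E : L2xL2n Ω →L[ℂ] L2xL2n Ω, ∀ w x, IsWeakSolution M l w x ↔ x = E w := by
  obtain ⟨δ, hδ, hcoer⟩ := exists_coercivity_constant ha hc hl
  let M' : L2n Ω →L[ℂ] L2n Ω := M.mkContinuous C hM
  let e := WithLp.prodContinuousLinearEquiv 2 ℂ (L2 Ω) (L2n Ω)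
  let B : L2xL2n Ω →L[ℂ] L2xL2n Ω := (e.symm : _ →L[ℂ] _) ∘L
    ((-(l : ℂ) • ContinuousLinearMap.id ℂ (L2 Ω)).prodMap M') ∘L (e : _ →L[ℂ] _)
  have hB : ∀ v w : L2xL2n Ω, ⟪v, B w⟫_ℂ =
      ⟪v.snd, M w.snd⟫_ℂ - ⟪v.fst, (l : ℂ) • w.fst⟫_ℂ := by
    intro v w
    rw [WithLp.prod_inner_apply]
    change ⟪v.fst, -(l : ℂ) • w.fst⟫_ℂ + ⟪v.snd, M w.snd⟫_ℂ = _
    rw [neg_smul, inner_neg_right]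
    ring
  obtain ⟨E, hE, hE'⟩ := exists_solution_of_coercive (gradGraph Ω) isClosed_gradGraph B hδ (by
    intro w hw
    rw [hB, Complex.sub_re, inner_smul_right, Complex.re_ofReal_mul]
    have h1 := hcoer _ _ (norm_nonneg w.fst) (norm_nonneg w.snd) (hP w hw)
    have h2 : (⟪w.fst, w.fst⟫_ℂ).re = ‖w.fst‖ ^ 2 := inner_self_eq_norm_sq (𝕜 := ℂ) w.fst
    rw [h2, WithLp.prod_norm_sq_eq_of_L2]
    linarith [haM w.snd])
  have hiff : ∀ w x : L2xL2n Ω, (∀ v ∈ gradGraph Ω, ⟪v, B x⟫_ℂ = ⟪v, w⟫_ℂ) ↔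
      ∀ v ∈ gradGraph Ω, ⟪v.snd, M x.snd - w.snd⟫_ℂ = ⟪v.fst, w.fst + (l : ℂ) • x.fst⟫_ℂ := by
    intro w x
    refine forall₂_congr fun v _ => ?_
    rw [hB, WithLp.prod_inner_apply, inner_sub_right, inner_add_right]
    change _ = ⟪v.fst, w.fst⟫_ℂ + ⟪v.snd, w.snd⟫_ℂ ↔ _
    constructor <;> intro h <;> linear_combination h
  refine ⟨E, fun w x => ⟨fun h => hE' w x h.1 ((hiff w x).2 h.2), ?_⟩⟩
  rintro rfl
  exact ⟨(hE w).1, (hiff _ _).1 (hE w).2⟩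

theorem exists_gradW_eq_of_mem_gradGraph {w : L2xL2n Ω} (hw : w ∈ gradGraph Ω) :
    ∃ h : w.fst ∈ (gradW Ω).domain, gradW Ω ⟨w.fst, h⟩ = w.snd := by
  obtain ⟨h1, h2⟩ := (mem_gradGraph_iff w).1 hw
  exact ⟨W10_le_W1 Ω h1, h2⟩

theorem norm_fst_le_of_mem_gradGraph {c : ℝ} {j : Fin n}
    (hP : ∀ u : (weakDeriv Ω j).domain, (u : L2 Ω) ∈ W10 Ω →
      c * ‖(u : L2 Ω)‖ ≤ ‖weakDeriv Ω j u‖) {w : L2xL2n Ω} (hw : w ∈ gradGraph Ω) :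
    c * ‖w.fst‖ ≤ ‖w.snd‖ := by
  obtain ⟨h1, h2⟩ := (mem_gradGraph_iff w).1 hw
  have h3 : weakDeriv Ω j ⟨w.fst, W1_le Ω j (W10_le_W1 Ω h1)⟩ = w.snd j := by
    rw [← h2]
    rfl
  exact (hP ⟨w.fst, W1_le Ω j (W10_le_W1 Ω h1)⟩ h1).trans
    (h3 ▸ PiLp.norm_apply_le w.snd j)

/-! ### Resolvents from the solution operator -/

section Solution

variable {r : EuclideanSpace ℝ (Fin n) → ℝ} {hm : MemLp (fun x => 1 / r x) ∞ (leb Ω)} {l : ℝ}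
  {E : L2xL2n Ω →L[ℂ] L2xL2n Ω}

theorem isResolventAt_diffusionOp
    (hE : ∀ w x, IsWeakSolution (mulVec (fun x => 1 / r x) hm) l w x ↔ x = E w)
    (R : L2 Ω →L[ℂ] L2 Ω) (hR : ∀ f, R f = (E (WithLp.toLp 2 (f, 0))).fst) :
    IsResolventAt (diffusionOp Ω r) l R := by
  constructor
  · rintro ⟨u, hu⟩
    obtain ⟨q, hq, h⟩ := (exists_diffusionOp_eq_iff r hm u _).1 ⟨hu, rfl⟩
    rw [hR, ← (hE _ (WithLp.toLp 2 (u, q))).1 ⟨hq, fun v hv => by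
      change ⟪v.snd, mulVec _ hm q - 0⟫_ℂ =
        ⟪v.fst, (diffusionOp Ω r ⟨u, hu⟩ - (l : ℂ) • u) + (l : ℂ) • u⟫_ℂ
      rw [sub_zero, sub_add_cancel]
      exact h v hv⟩]
    rfl
  · intro f
    obtain ⟨h1, h2⟩ := (hE (WithLp.toLp 2 (f, 0)) _).2 rfl
    obtain ⟨h3, h4⟩ := (exists_diffusionOp_eq_iff r hm (R f) (f + (l : ℂ) • R f)).2
      ⟨(E (WithLp.toLp 2 (f, 0))).snd, by rw [hR]; exact h1, fun v hv => by
        have := h2 v hv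
        rw [hR]
        change ⟪v.snd, _ - (0 : L2n Ω)⟫_ℂ = _ at this
        rwa [sub_zero] at this⟩
    exact ⟨h3, by rw [h4, add_sub_cancel_right]⟩

/-- A source ∇₀^* q acts on v as ⟪∇v, q⟫, which is exactly the effect of q in the second slot. -/
theorem weakSolution_grad0Adj
    (hE : ∀ w x, IsWeakSolution (mulVec (fun x => 1 / r x) hm) l w x ↔ x = E w)
    (q : (grad0Adj Ω).domain) :
    E (WithLp.toLp 2 (grad0Adj Ω q, 0)) = E (WithLp.toLp 2 (0, (q : L2n Ω))) := by
  obtain ⟨h1, h2⟩ := (hE (WithLp.toLp 2 (grad0Adj Ω q, 0)) _).2 rfl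
  refine (hE _ _).1 ⟨h1, fun v hv => ?_⟩
  have h3 := h2 v hv
  have h4 := (exists_grad0Adj_eq_iff _ _).1 ⟨q.2, rfl⟩ v hv
  rw [inner_sub_right, inner_add_right] at h3 ⊢
  change _ - ⟪v.snd, (0 : L2n Ω)⟫_ℂ = ⟪v.fst, grad0Adj Ω q⟫_ℂ + _ at h3
  change _ - ⟪v.snd, (q : L2n Ω)⟫_ℂ = ⟪v.fst, (0 : L2 Ω)⟫_ℂ + _
  change ⟪v.snd, (q : L2n Ω)⟫_ℂ = ⟪v.fst, grad0Adj Ω q⟫_ℂ at h4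
  rw [inner_zero_right] at h3 ⊢
  linear_combination h3 - h4

/-- Elimination of q: the second row reads ∇u - (p + l)q = g and is solved for q by `M`, the inverse
of multiplication by p + l. -/
theorem isResolventAt_firstOrderOp (p : EuclideanSpace ℝ (Fin n) → ℝ) (hp : MemLp p ∞ (leb Ω))
    (hr : MemLp (fun x => p x + l) ∞ (leb Ω)) (hm : MemLp (fun x => 1 / (p x + l)) ∞ (leb Ω))
    (h0 : ∀ᵐ x ∂(leb Ω), p x + l ≠ 0)
    (hE : ∀ w x, IsWeakSolution (mulVec (fun x => 1 / (p x + l)) hm) l w x ↔ x = E w)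
    (R : L2xL2n Ω →L[ℂ] L2xL2n Ω)
    (hR : ∀ f g, R (WithLp.toLp 2 (f, g)) =
      WithLp.toLp 2 ((E (WithLp.toLp 2 (f, mulVec (fun x => 1 / (p x + l)) hm g))).fst,
        mulVec (fun x => 1 / (p x + l)) hm
          ((E (WithLp.toLp 2 (f, mulVec (fun x => 1 / (p x + l)) hm g))).snd - g))) :
    IsResolventAt (firstOrderOp p hp) l R := by
  set M := mulVec (fun x => 1 / (p x + l)) hm with hM
  have hMr : ∀ q, M (mulVec p hp q + (l : ℂ) • q) = q := fun q => by
    rw [← mulVec_add_const p l hp hr]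
    refine mulVec_mulVec _ _ hm hr ?_ q
    filter_upwards [h0] with x hx
    rw [one_div, inv_mul_cancel₀ hx]
  have hrM : ∀ q, mulVec p hp (M q) + (l : ℂ) • M q = q := fun q => by
    rw [← mulVec_add_const p l hp hr]
    refine mulVec_mulVec _ _ hr hm ?_ q
    filter_upwards [h0] with x hx
    rw [one_div, mul_inv_cancel₀ hx]
  constructor
  · rintro ⟨w, hw⟩
    obtain ⟨h1, h2⟩ := (exists_firstOrderOp_eq_iff p hp w _).1 ⟨hw, rfl⟩
    set z := firstOrderOp p hp ⟨w, hw⟩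
    -- With z = Âw, the two arguments are ∇u and the datum g, so this is q = M∇u - Mg.
    have h3 : M (z.snd + mulVec p hp w.snd) - M (z.snd - (l : ℂ) • w.snd) = w.snd := by
      rw [← map_sub]
      convert hMr w.snd using 2
      abel
    have h4 := (hE (WithLp.toLp 2 (z.fst - (l : ℂ) • w.fst, M (z.snd - (l : ℂ) • w.snd)))
      (WithLp.toLp 2 (w.fst, z.snd + mulVec p hp w.snd))).1 ⟨h1, fun v hv => by
        change ⟪v.snd, M (z.snd + mulVec p hp w.snd) - M (z.snd - (l : ℂ) • w.snd)⟫_ℂ =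
          ⟪v.fst, (z.fst - (l : ℂ) • w.fst) + (l : ℂ) • w.fst⟫_ℂ
        rw [h3, sub_add_cancel]
        exact h2 v hv⟩
    change R (WithLp.toLp 2 (z.fst - (l : ℂ) • w.fst, z.snd - (l : ℂ) • w.snd)) = w
    rw [hR, ← h4]
    change WithLp.toLp 2 (w.fst,
      M (z.snd + mulVec p hp w.snd - (z.snd - (l : ℂ) • w.snd))) = w
    rw [map_sub, h3]
    rfl
  · intro z
    set x := E (WithLp.toLp 2 (z.fst, M z.snd)) with hx
    have hRz : R z = WithLp.toLp 2 (x.fst, M (x.snd - z.snd)) := hR z.fst z.snd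
    obtain ⟨h1, h2⟩ := (hE _ _).2 hx
    obtain ⟨h3, h4⟩ := (exists_firstOrderOp_eq_iff p hp (R z) (z + (l : ℂ) • R z)).2 (by
      rw [hRz]
      refine ⟨?_, fun v hv => ?_⟩
      · change WithLp.toLp 2 (x.fst, (z.snd + (l : ℂ) • M (x.snd - z.snd)) +
          mulVec p hp (M (x.snd - z.snd))) ∈ gradGraph Ω
        rw [add_assoc, add_comm ((l : ℂ) • _), hrM, add_sub_cancel]
        exact h1
      · change ⟪v.snd, M (x.snd - z.snd)⟫_ℂ = ⟪v.fst, z.fst + (l : ℂ) • x.fst⟫_ℂ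
        rw [map_sub]
        exact h2 v hv)
    exact ⟨h3, by rw [h4, add_sub_cancel_right]⟩

end Solution

end Diffusion

/-! ### The resolvent formula -/

theorem mainTheorem3 {n : ℕ} (Ω : Opens (EuclideanSpace ℝ (Fin n)))
    (hΩ : (Ω : Set (EuclideanSpace ℝ (Fin n))).Nonempty)
    (c : ℝ) (hc : 0 < c) (j : Fin n)
    (hPoincare : ∀ u : (weakDeriv Ω j).domain, (u : L2 Ω) ∈ W10 Ω →
      c * ‖(u : L2 Ω)‖ ≤ ‖weakDeriv Ω j u‖)
    (p : EuclideanSpace ℝ (Fin n) → ℝ) (hp : p ∈ diffusivities Ω)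
    (C₁ C₂ : ℝ) (hC₁ : 0 < C₁) (hC₁₂ : C₁ ≤ C₂)
    (hC : ∀ᵐ x ∂(leb Ω), C₁ ≤ p x ∧ p x ≤ C₂)
    (l : ℝ) (hl : l ∈ Set.Ioo (-C₁) (c ^ 2 / (c + C₂))) :
    (l : ℂ) ∈ opResolventSet (firstOrderOp p hp.1) ∧
    (fun x => p x + l) ∈ diffusivities Ω ∧
    (l : ℂ) ∈ opResolventSet (diffusionOp Ω (fun x => p x + l)) ∧
    ∃ hpl : MemLp (fun x => 1 / (p x + l)) ∞ (leb Ω),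
    ∃ (R : L2 Ω →L[ℂ] L2 Ω)
      (G : L2 Ω →L[ℂ] L2n Ω)
      (S : L2n Ω →L[ℂ] L2 Ω)
      (K : L2n Ω →L[ℂ] L2n Ω),
      R = opResolvent (diffusionOp Ω (fun x => p x + l)) l ∧
      compOp (gradW Ω) (R.toLinearMap.toPMap ⊤) = G.toLinearMap.toPMap ⊤ ∧
      (R.toLinearMap.compPMap (grad0Adj Ω)).IsClosable ∧
      (R.toLinearMap.compPMap (grad0Adj Ω)).closure = S.toLinearMap.toPMap ⊤ ∧
      (compOp (gradW Ω)
        (R.toLinearMap.compPMap (grad0Adj Ω))).IsClosable ∧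
      (compOp (gradW Ω)
        (R.toLinearMap.compPMap (grad0Adj Ω))).closure = K.toLinearMap.toPMap ⊤ ∧
      ∀ (f : L2 Ω) (g : L2n Ω),
        opResolvent (firstOrderOp p hp.1) l (WithLp.toLp 2 (f, g)) =
          WithLp.toLp 2 (R f + S (mulVec (fun x => 1 / (p x + l)) hpl g),
            -mulVec (fun x => 1 / (p x + l)) hpl g + mulVec (fun x => 1 / (p x + l)) hpl (G f) +
              mulVec (fun x => 1 / (p x + l)) hpl (K (mulVec (fun x => 1 / (p x + l)) hpl g))) := by
  obtain ⟨hl1, hl2⟩ := hl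
  have hCl1 : 0 < C₁ + l := by linarith
  have hCl2 : 0 < C₂ + l := by linarith
  have hb : ∀ᵐ x ∂(leb Ω), C₁ + l ≤ p x + l ∧ p x + l ≤ C₂ + l := by
    filter_upwards [hC] with x hx
    exact ⟨by linarith [hx.1], by linarith [hx.2]⟩
  have h0 : ∀ᵐ x ∂(leb Ω), p x + l ≠ 0 := by
    filter_upwards [hb] with x hx
    exact (hCl1.trans_le hx.1).ne'
  have hmeas : AEStronglyMeasurable (fun x => p x + l) (leb Ω) :=
    hp.1.aestronglyMeasurable.add aestronglyMeasurable_const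
  have hr : MemLp (fun x => p x + l) ∞ (leb Ω) := by
    refine memLp_top_of_bound hmeas (C₂ + l) ?_
    filter_upwards [hb] with x hx
    rw [Real.norm_eq_abs, abs_of_nonneg (hCl1.le.trans hx.1)]
    exact hx.2
  have habs : ∀ᵐ x ∂(leb Ω), |1 / (p x + l)| ≤ 1 / (C₁ + l) := by
    filter_upwards [hb] with x hx
    rw [abs_of_nonneg (one_div_nonneg.2 (hCl1.le.trans hx.1))]
    exact one_div_le_one_div_of_le hCl1 hx.1
  have hpl : MemLp (fun x => 1 / (p x + l)) ∞ (leb Ω) :=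
    memLp_top_of_bound (hmeas.aemeasurable.const_div 1).aestronglyMeasurable (1 / (C₁ + l)) habs
  have hlow : ∀ᵐ x ∂(leb Ω), 1 / (C₂ + l) ≤ 1 / (p x + l) := by
    filter_upwards [hb] with x hx
    exact one_div_le_one_div_of_le (hCl1.trans_le hx.1) hx.2
  -- The claim is l(C₂ + l) < c². For l ≤ 0 the left side is nonpositive; for l > 0, l(c + C₂) < c²
  -- forces l < c, hence l(C₂ + l) < l(C₂ + c) < c².
  have hlc : l < 1 / (C₂ + l) * c ^ 2 := by
    rw [one_div_mul_eq_div, lt_div_iff₀ hCl2]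
    rw [lt_div_iff₀ (by linarith)] at hl2
    rcases le_or_gt l 0 with h | h
    · nlinarith [mul_nonneg (neg_nonneg.2 h) hCl2.le, pow_pos hc 2]
    · have : l < c := by nlinarith [mul_pos h (hC₁.trans_le hC₁₂)]
      nlinarith
  have hMb := norm_mulVec_le _ hpl (one_div_pos.2 hCl1).le habs
  obtain ⟨E, hE⟩ := exists_isWeakSolution_iff (mulVec (fun x => 1 / (p x + l)) hpl) hMb
    (one_div_pos.2 hCl2) hc (le_re_inner_mulVec _ hpl hlow)
    (fun _ => norm_fst_le_of_mem_gradGraph hPoincare) hlc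
  have hEmem : ∀ w, E w ∈ gradGraph Ω := fun w => ((hE w _).2 rfl).1
  let M : L2n Ω →L[ℂ] L2n Ω := (mulVec (fun x => 1 / (p x + l)) hpl).mkContinuous _ hMb
  let e : (L2 Ω × L2n Ω) →L[ℂ] L2xL2n Ω :=
    (WithLp.prodContinuousLinearEquiv 2 ℂ (L2 Ω) (L2n Ω)).symm.toContinuousLinearMap
  let i₁ : L2 Ω →L[ℂ] L2xL2n Ω := e ∘L ContinuousLinearMap.inl ℂ _ _
  let i₂ : L2n Ω →L[ℂ] L2xL2n Ω := e ∘L ContinuousLinearMap.inr ℂ _ _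
  let π₁ : L2xL2n Ω →L[ℂ] L2 Ω := WithLp.fstL 2 ℂ (L2 Ω) (L2n Ω)
  let π₂ : L2xL2n Ω →L[ℂ] L2n Ω := WithLp.sndL 2 ℂ (L2 Ω) (L2n Ω)
  let F : L2xL2n Ω →L[ℂ] L2xL2n Ω := E ∘L (i₁ ∘L π₁ + i₂ ∘L M ∘L π₂)
  -- Since F(f, g) = E(f, Mg) = (u, ∇u), this is (f, g) ↦ (u, M(∇u - g)).
  let R₁ : L2xL2n Ω →L[ℂ] L2xL2n Ω := i₁ ∘L π₁ ∘L F + i₂ ∘L M ∘L (π₂ ∘L F - π₂)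
  have hi : ∀ (f : L2 Ω) (g : L2n Ω), i₁ f + i₂ g = WithLp.toLp 2 (f, g) := fun f g => by
    change WithLp.toLp 2 ((f, 0) + (0, g)) = _
    rw [Prod.mk_add_mk, add_zero, zero_add]
  have hR₁ : ∀ f g, R₁ (WithLp.toLp 2 (f, g)) =
      WithLp.toLp 2 ((E (WithLp.toLp 2 (f, M g))).fst,
        M ((E (WithLp.toLp 2 (f, M g))).snd - g)) := fun f g => by
    rw [← hi f (M g), ← hi (E _).fst]
    rfl
  have hres := isResolventAt_firstOrderOp p hp.1 hr hpl h0 hE R₁ hR₁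
  have hdiff := isResolventAt_diffusionOp (r := fun x => p x + l) hE (π₁ ∘L E ∘L i₁) fun _ => rfl
  have hclos₁ := closure_eq_of_dense_domain
    ((π₁ ∘L E ∘L i₁).toLinearMap.compPMap (grad0Adj Ω)) dense_grad0Adj_domain (π₁ ∘L E ∘L i₂)
    fun q => congrArg WithLp.fst (weakSolution_grad0Adj hE q)
  -- Values of `E` lie in the gradient graph, so composing with ∇_w loses none of the domain of
  -- ∇₀^*, and density persists.
  have hdom : ∀ q : (grad0Adj Ω).domain,
      ∃ h : (π₁ ∘L E ∘L i₁).toLinearMap.compPMap (grad0Adj Ω) q ∈ (gradW Ω).domain,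
        gradW Ω ⟨_, h⟩ = (π₂ ∘L E ∘L i₂) (q : L2n Ω) := fun q => by
    obtain ⟨h, h'⟩ := exists_gradW_eq_of_mem_gradGraph (hEmem (WithLp.toLp 2 (grad0Adj Ω q, 0)))
    exact ⟨h, h'.trans (congrArg WithLp.snd (weakSolution_grad0Adj hE q))⟩
  have hclos₂ := closure_eq_of_dense_domain
    (compOp (gradW Ω) ((π₁ ∘L E ∘L i₁).toLinearMap.compPMap (grad0Adj Ω)))
    (dense_grad0Adj_domain.mono fun q hq => ⟨⟨q, hq⟩, (hdom ⟨q, hq⟩).1, rfl⟩)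
    (π₂ ∘L E ∘L i₂) fun q => by
      obtain ⟨_, ⟨q, hq⟩, _, rfl⟩ := q
      exact (hdom ⟨q, hq⟩).2
  refine ⟨⟨R₁, hres⟩, ⟨hr, C₁ + l, C₂ + l, hCl1, by linarith, hb⟩, ⟨_, hdiff⟩, hpl,
    π₁ ∘L E ∘L i₁, π₂ ∘L E ∘L i₁, π₁ ∘L E ∘L i₂, π₂ ∘L E ∘L i₂, hdiff.eq_opResolvent.symm,
    compOp_eq_toPMap _ _ _ fun f => exists_gradW_eq_of_mem_gradGraph (hEmem (i₁ f)),
    hclos₁.1, hclos₁.2, hclos₂.1, hclos₂.2, fun f g => ?_⟩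
  rw [hres.eq_opResolvent, hR₁, ← hi f (M g), map_add]
  change WithLp.toLp 2 ((E (i₁ f)).fst + (E (i₂ (M g))).fst,
    M ((E (i₁ f)).snd + (E (i₂ (M g))).snd - g)) = _
  rw [map_sub, map_add, sub_eq_neg_add, ← add_assoc]
  rfl
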